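/- Let $A$ be a Hopf algebra over $\mathbb{C}$ (unital, with coproduct $\Delta$, counit $\varepsilon$) whose antipode is bijective. A \emph{quantum homogeneous $A$-space} is a subalgebra $B \subseteq A$ such that $\Delta(B) \subseteq A \otimes B$, $A$ is faithfully flat as a right $B$-module (the functor $A\otimes_B -$ on left $B$-modules preserves and reflects exact sequences), and $B^+A = AB^+$, where $B^+ := B \cap \ker \varepsilon$. In this case $B^+A$ is a Hopf ideal, and we write $\pi_B : A \to \pi_B(A) := A/B^+A$ for the quotient map onto the quotient Hopf algebra. Let ${}^A_B\mathrm{Mod}$ denote the category of relative Hopf modules: its objects are left $B$-modules $\mathcal{F}$ with a left $A$-coaction $\Delta_L$ satisfying $\Delta_L(bf) = \Delta(b)\Delta_L(f)$ for $b\in B$, $f\in\mathcal{F}$, and its morphisms are the left $B$-module, left $A$-comodule maps. For a left $\pi_B(A)$-comodule $(V,\delta)$, let $$ A \,\square_{\pi_B} V := \Big\{ \textstyle\sum_i a_i \otimes v_i \in A \otimes V \;:\; \sum_i (a_i)_{(1)} \otimes \pi_B\big((a_i)_{(2)}\big) \otimes v_i = \sum_i a_i \otimes \delta(v_i) \Big\}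 $$ be the cotensor product, an object of ${}^A_B\mathrm{Mod}$ with left $B$-action and left $A$-coaction given by those of the first tensor factor. Let $B \subseteq P \subseteq A$ be quantum homogeneous $A$-spaces, let $\pi_{B,P} : \pi_B(A) \to \pi_P(A)$, $\pi_B(a) \mapsto \pi_P(a)$, and let $$ \pi_B(A)^{\mathrm{co}(\pi_P(A))} := \{ x \in \pi_B(A) : (\mathrm{id} \otimes \pi_{B,P})\Delta(x) = x \otimes 1 \}, $$ which is a left $\pi_B(A)$-subcomodule of $\pi_B(A)$. Regard $P$ as an object of ${}^A_B\mathrm{Mod}$ through left multiplication by $B$ and the restriction $P \to A \otimes P$ of $\Delta$. Then: \begin{enumerate} \item an isomorphism in the category ${}^A_B\mathrm{Mod}$ is given by $$ P \to A \,\square_{\pi_B} \big(\pi_B(A)^{\mathrm{co}(\pi_P(A))}\big), \qquad p \mapsto p_{(1)} \otimes \pi_B(p_{(2)}); $$ \item $\pi_B(P) = \pi_B(A)^{\mathrm{co}(\pi_P(A))}$. \end{enumerate} -/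

import Mathlib

open scoped TensorProduct
open CategoryTheory

universe u

namespace QHS

/-! ### Linear maps into a tensor product that land in a subspace -/

section Lift

variable {X C W V : Type u} [AddCommGroup X] [Module ℂ X] [AddCommGroup C] [Module ℂ C]
  [AddCommGroup W] [Module ℂ W] [AddCommGroup V] [Module ℂ V]

theorem lTensor_inj (C : Type u) [AddCommGroup C] [Module ℂ C] (ι : W →ₗ[ℂ] V)
    (hι : Function.Injective ι) : Function.Injective (ι.lTensor C) :=
  Module.Flat.lTensor_preserves_injective_linearMap ι hι

/-- If `f : X → C ⊗ V` takes values in (the image of) `C ⊗ W`, where `ι : W → V` is injective,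
this is `f` regarded as a map `X → C ⊗ W`. -/
noncomputable def corestrict (f : X →ₗ[ℂ] C ⊗[ℂ] V) (ι : W →ₗ[ℂ] V)
    (hι : Function.Injective ι) (h : ∀ x, f x ∈ LinearMap.range (ι.lTensor C)) :
    X →ₗ[ℂ] C ⊗[ℂ] W :=
  (LinearEquiv.ofInjective (ι.lTensor C) (lTensor_inj C ι hι)).symm.toLinearMap ∘ₗ
    f.codRestrict _ h

theorem lTensor_corestrict (f : X →ₗ[ℂ] C ⊗[ℂ] V) (ι : W →ₗ[ℂ] V)
    (hι : Function.Injective ι) (h : ∀ x, f x ∈ LinearMap.range (ι.lTensor C)) (x : X) :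
    ι.lTensor C (corestrict f ι hι h x) = f x := by
  have := LinearEquiv.apply_symm_apply
    (LinearEquiv.ofInjective (ι.lTensor C) (lTensor_inj C ι hι)) (f.codRestrict _ h x)
  exact congrArg Subtype.val this

theorem mem_range_lTensor_of_ker {Y : Type u} [AddCommGroup Y] [Module ℂ Y]
    (θ : V →ₗ[ℂ] Y) (ι : W →ₗ[ℂ] V) (hex : Function.Exact ι θ) (t : C ⊗[ℂ] V)
    (ht : θ.lTensor C t = 0) : t ∈ LinearMap.range (ι.lTensor C) :=
  (Module.Flat.lTensor_exact C hex t).1 ht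

/-- Coassociativity of a coaction passes to subspaces. -/
theorem coassoc_of_injective [Coalgebra ℂ C] (ι : W →ₗ[ℂ] V) (hι : Function.Injective ι)
    (δ : V →ₗ[ℂ] C ⊗[ℂ] V) (δW : W →ₗ[ℂ] C ⊗[ℂ] W)
    (hδ : ∀ w, ι.lTensor C (δW w) = δ (ι w))
    (hco : ∀ v, TensorProduct.assoc ℂ C C V
        ((Coalgebra.comul (R := ℂ) (A := C)).rTensor V (δ v)) = δ.lTensor C (δ v)) (w : W) :
    TensorProduct.assoc ℂ C C W ((Coalgebra.comul (R := ℂ) (A := C)).rTensor W (δW w)) =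
      δW.lTensor C (δW w) := by
  apply lTensor_inj C (ι.lTensor C) (lTensor_inj C ι hι)
  have nat : ∀ t : C ⊗[ℂ] W, (ι.lTensor C).lTensor C
      (TensorProduct.assoc ℂ C C W ((Coalgebra.comul (R := ℂ) (A := C)).rTensor W t)) =
      TensorProduct.assoc ℂ C C V ((Coalgebra.comul (R := ℂ) (A := C)).rTensor V
        (ι.lTensor C t)) := by
    intro t
    induction t with
    | zero => simp
    | add x y hx hy => simp only [map_add, hx, hy]
    | tmul c w =>
      simp only [LinearMap.rTensor_tmul, LinearMap.lTensor_tmul]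
      induction Coalgebra.comul (R := ℂ) c with
      | zero => simp
      | add x y hx hy => simp only [map_add, TensorProduct.add_tmul, hx, hy]
      | tmul a b => simp
  have hcomp : ι.lTensor C ∘ₗ δW = δ ∘ₗ ι := LinearMap.ext hδ
  rw [nat, hδ, hco, ← LinearMap.lTensor_comp_apply, hcomp, LinearMap.lTensor_comp_apply, hδ]

/-- Counitality of a coaction passes to subspaces. -/
theorem counit_of_injective [Coalgebra ℂ C] (ι : W →ₗ[ℂ] V) (hι : Function.Injective ι)
    (δ : V →ₗ[ℂ] C ⊗[ℂ] V) (δW : W →ₗ[ℂ] C ⊗[ℂ] W)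
    (hδ : ∀ w, ι.lTensor C (δW w) = δ (ι w))
    (hco : ∀ v, TensorProduct.lid ℂ V
        ((Coalgebra.counit (R := ℂ) (A := C)).rTensor V (δ v)) = v) (w : W) :
    TensorProduct.lid ℂ W ((Coalgebra.counit (R := ℂ) (A := C)).rTensor W (δW w)) = w := by
  apply hι
  have nat : ∀ t : C ⊗[ℂ] W, ι
      (TensorProduct.lid ℂ W ((Coalgebra.counit (R := ℂ) (A := C)).rTensor W t)) =
      TensorProduct.lid ℂ V ((Coalgebra.counit (R := ℂ) (A := C)).rTensor V
        (ι.lTensor C t)) := by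
    intro t
    induction t with
    | zero => simp
    | add x y hx hy => simp only [map_add, hx, hy]
    | tmul c w => simp
  rw [nat, hδ, hco]

/-- The coproduct on the first factor of `C ⊗ V`. -/
noncomputable def comulLeft (C V : Type u) [AddCommGroup C] [Module ℂ C] [AddCommGroup V]
    [Module ℂ V] [Coalgebra ℂ C] : C ⊗[ℂ] V →ₗ[ℂ] C ⊗[ℂ] (C ⊗[ℂ] V) :=
  (TensorProduct.assoc ℂ C C V).toLinearMap ∘ₗ (Coalgebra.comul (R := ℂ) (A := C)).rTensor V

theorem comulLeft_tmul [Coalgebra ℂ C] (c : C) (v : V) :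
    comulLeft C V (c ⊗ₜ v) =
      ((TensorProduct.mk ℂ C V).flip v).lTensor C (Coalgebra.comul (R := ℂ) c) := by
  simp only [comulLeft, LinearMap.comp_apply, LinearMap.rTensor_tmul, LinearEquiv.coe_coe]
  induction Coalgebra.comul (R := ℂ) c with
  | zero => simp
  | add x y hx hy => simp only [map_add, TensorProduct.add_tmul, hx, hy]
  | tmul a b => simp

theorem comulLeft_coassoc [Coalgebra ℂ C] (x : C ⊗[ℂ] V) :
    TensorProduct.assoc ℂ C C (C ⊗[ℂ] V)
      ((Coalgebra.comul (R := ℂ) (A := C)).rTensor _ (comulLeft C V x)) =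
    (comulLeft C V).lTensor C (comulLeft C V x) := by
  induction x with
  | zero => simp
  | add x y hx hy => simp only [map_add, hx, hy]
  | tmul c v =>
    rw [comulLeft_tmul]
    have h1 : ∀ t : C ⊗[ℂ] C, TensorProduct.assoc ℂ C C (C ⊗[ℂ] V)
        ((Coalgebra.comul (R := ℂ) (A := C)).rTensor _
          (((TensorProduct.mk ℂ C V).flip v).lTensor C t)) =
        (((TensorProduct.mk ℂ C V).flip v).lTensor C).lTensor C
          (TensorProduct.assoc ℂ C C C ((Coalgebra.comul (R := ℂ) (A := C)).rTensor _ t)) := by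
      intro t
      induction t with
      | zero => simp
      | add x y hx hy => simp only [map_add, hx, hy]
      | tmul a b =>
        simp only [LinearMap.rTensor_tmul, LinearMap.lTensor_tmul]
        induction Coalgebra.comul (R := ℂ) a with
        | zero => simp
        | add x y hx hy => simp only [map_add, TensorProduct.add_tmul, hx, hy]
        | tmul a b => simp
    have h2 : comulLeft C V ∘ₗ (TensorProduct.mk ℂ C V).flip v =
        ((TensorProduct.mk ℂ C V).flip v).lTensor C ∘ₗ Coalgebra.comul (R := ℂ) :=
      LinearMap.ext fun c => comulLeft_tmul c v
    rw [h1, Coalgebra.coassoc_apply, ← LinearMap.lTensor_comp_apply,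
      ← LinearMap.lTensor_comp_apply, h2]

theorem comulLeft_counit [Coalgebra ℂ C] (x : C ⊗[ℂ] V) :
    TensorProduct.lid ℂ (C ⊗[ℂ] V)
      ((Coalgebra.counit (R := ℂ) (A := C)).rTensor _ (comulLeft C V x)) = x := by
  induction x with
  | zero => simp
  | add x y hx hy => simp only [map_add, hx, hy]
  | tmul c v =>
    have h1 : ∀ t : C ⊗[ℂ] C, TensorProduct.lid ℂ (C ⊗[ℂ] V)
        ((Coalgebra.counit (R := ℂ) (A := C)).rTensor _
          (((TensorProduct.mk ℂ C V).flip v).lTensor C t)) =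
        TensorProduct.lid ℂ C ((Coalgebra.counit (R := ℂ) (A := C)).rTensor _ t) ⊗ₜ v := by
      intro t
      induction t with
      | zero => simp
      | add x y hx hy => simp only [map_add, TensorProduct.add_tmul, hx, hy]
      | tmul a b => simp [TensorProduct.smul_tmul']
    rw [comulLeft_tmul, h1, Coalgebra.rTensor_counit_comul]
    simp

end Lift

/-! ### Faithful flatness of an algebra as a right module over a subalgebra -/

section FaithfullyFlat

variable {A : Type u} [Ring A] [Algebra ℂ A] (B : Subalgebra ℂ A)

/-- The relations `a b ⊗ m = a ⊗ b m` in `A ⊗ M`, for `a ∈ A`, `b ∈ B`, `m ∈ M`. -/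
def balancedRelations (M : Type u) [AddCommGroup M] [Module ℂ M] [Module B M] :
    Submodule ℂ (A ⊗[ℂ] M) :=
  Submodule.span ℂ
    {x | ∃ (a : A) (b : B) (m : M), x = (a * (b : A)) ⊗ₜ[ℂ] m - a ⊗ₜ[ℂ] (b • m)}

/-- The tensor product `A ⊗_B M` of the right `B`-module `A` with a left `B`-module `M`. -/
abbrev TensorOver (M : Type u) [AddCommGroup M] [Module ℂ M] [Module B M] : Type u :=
  (A ⊗[ℂ] M) ⧸ balancedRelations B M

variable {M N : Type u} [AddCommGroup M] [Module ℂ M] [Module B M] [IsScalarTower ℂ B M]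
  [AddCommGroup N] [Module ℂ N] [Module B N] [IsScalarTower ℂ B N]

theorem balancedRelations_le_comap (f : M →ₗ[B] N) :
    balancedRelations B M ≤
      (balancedRelations B N).comap ((f.restrictScalars ℂ).lTensor A) := by
  refine Submodule.span_le.2 ?_
  rintro _ ⟨a, b, m, rfl⟩
  refine Submodule.subset_span ⟨a, b, f m, ?_⟩
  simp

/-- The map `id_A ⊗_B f : A ⊗_B M → A ⊗_B N` induced by a left `B`-module map `f`. -/
def TensorOver.map (f : M →ₗ[B] N) : TensorOver B M →ₗ[ℂ] TensorOver B N :=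
  Submodule.mapQ _ _ ((f.restrictScalars ℂ).lTensor A) (balancedRelations_le_comap B f)

/-- `A` is faithfully flat as a right `B`-module: the functor `A ⊗_B -` on left `B`-modules
preserves and reflects exact sequences. -/
def IsRightFaithfullyFlat : Prop :=
  ∀ (M₁ M₂ M₃ : Type u)
    [AddCommGroup M₁] [Module ℂ M₁] [Module B M₁] [IsScalarTower ℂ B M₁]
    [AddCommGroup M₂] [Module ℂ M₂] [Module B M₂] [IsScalarTower ℂ B M₂]
    [AddCommGroup M₃] [Module ℂ M₃] [Module B M₃] [IsScalarTower ℂ B M₃]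
    (f : M₁ →ₗ[B] M₂) (g : M₂ →ₗ[B] M₃),
    Function.Exact f g ↔ Function.Exact (TensorOver.map B f) (TensorOver.map B g)

end FaithfullyFlat

/-! ### Quantum homogeneous spaces -/

section Spaces

variable {A : Type u} [Ring A] [HopfAlgebra ℂ A]

theorem mul_mem_mono {M M' N N' : Submodule ℂ A} (h : M ≤ M') (h' : N ≤ N') {x : A}
    (hx : x ∈ M * N) : x ∈ M' * N' :=
  (Submodule.mul_le (P := M' * N')).2
    (fun _ hm _ hn => Submodule.mul_mem_mul (h hm) (h' hn)) hx

/-- `B⁺ = B ∩ ker ε`. -/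
def augmentation (B : Subalgebra ℂ A) : Submodule ℂ A :=
  Subalgebra.toSubmodule B ⊓ LinearMap.ker (Coalgebra.counit (R := ℂ) (A := A))

/-- A quantum homogeneous `A`-space: a left coideal subalgebra `B ⊆ A` (so `Δ(B) ⊆ A ⊗ B`) such
that `A` is faithfully flat as a right `B`-module and `B⁺A = AB⁺`. -/
class IsQuantumHomogeneousSpace (B : Subalgebra ℂ A) : Prop where
  left_coideal : ∀ b ∈ B, Coalgebra.comul (R := ℂ) b ∈ LinearMap.range (B.val.toLinearMap.lTensor A)
  faithfullyFlat : IsRightFaithfullyFlat B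
  augmentation_mul : augmentation B * (⊤ : Submodule ℂ A) = (⊤ : Submodule ℂ A) * augmentation B

variable (B : Subalgebra ℂ A) [hB : IsQuantumHomogeneousSpace B]

/-- The ideal `B⁺A = AB⁺` of `A`. -/
def augmentationIdeal : Ideal A where
  carrier := (augmentation B * (⊤ : Submodule ℂ A) : Submodule ℂ A)
  add_mem' := Submodule.add_mem _
  zero_mem' := Submodule.zero_mem _
  smul_mem' a x hx := by
    have hx' : x ∈ augmentation B * (⊤ : Submodule ℂ A) := hx
    change a * x ∈ augmentation B * (⊤ : Submodule ℂ A)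
    rw [hB.augmentation_mul] at hx' ⊢
    have h : a * x ∈ (⊤ : Submodule ℂ A) * ((⊤ : Submodule ℂ A) * augmentation B) :=
      Submodule.mul_mem_mul Submodule.mem_top hx'
    rw [← mul_assoc] at h
    exact mul_mem_mono le_top le_rfl h

theorem mem_augmentationIdeal {x : A} :
    x ∈ augmentationIdeal B ↔ x ∈ augmentation B * (⊤ : Submodule ℂ A) := Iff.rfl

theorem mem_augmentationIdeal_of_mem {b : A} (hb : b ∈ B)
    (h0 : Coalgebra.counit (R := ℂ) b = 0) : b ∈ augmentationIdeal B := by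
  rw [mem_augmentationIdeal, ← mul_one b]
  exact Submodule.mul_mem_mul ⟨hb, h0⟩ Submodule.mem_top

instance : (augmentationIdeal B).IsTwoSided where
  mul_mem_of_left {x} a hx := by
    rw [mem_augmentationIdeal] at hx ⊢
    have h : x * a ∈ (augmentation B * (⊤ : Submodule ℂ A)) * (⊤ : Submodule ℂ A) :=
      Submodule.mul_mem_mul hx Submodule.mem_top
    rw [mul_assoc] at h
    exact mul_mem_mono le_rfl le_top h

theorem mk_eq_counit {b : A} (hb : b ∈ B) :
    Ideal.Quotient.mkₐ ℂ (augmentationIdeal B) b =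
      algebraMap ℂ (A ⧸ augmentationIdeal B) (Coalgebra.counit (R := ℂ) b) := by
  have h : b - algebraMap ℂ A (Coalgebra.counit (R := ℂ) b) ∈ augmentationIdeal B :=
    mem_augmentationIdeal_of_mem B (B.sub_mem hb (B.algebraMap_mem _)) (by simp)
  exact (Ideal.Quotient.mk_eq_mk_iff_sub_mem _ _).2 h

theorem lTensor_mk_comul {b : A} (hb : b ∈ B) :
    (Ideal.Quotient.mkₐ ℂ (augmentationIdeal B)).toLinearMap.lTensor A
      (Coalgebra.comul (R := ℂ) b) = b ⊗ₜ[ℂ] (1 : A ⧸ augmentationIdeal B) := by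
  obtain ⟨t, ht⟩ := hB.left_coideal b hb
  have key : ∀ t : A ⊗[ℂ] B,
      (Ideal.Quotient.mkₐ ℂ (augmentationIdeal B)).toLinearMap.lTensor A
        (B.val.toLinearMap.lTensor A t) =
      (Algebra.linearMap ℂ (A ⧸ augmentationIdeal B)).lTensor A
        ((Coalgebra.counit (R := ℂ) (A := A)).lTensor A (B.val.toLinearMap.lTensor A t)) := by
    intro t
    induction t with
    | zero => simp
    | add x y hx hy => simp only [map_add, hx, hy]
    | tmul a b => simpa using congrArg (fun z => a ⊗ₜ[ℂ] z) (mk_eq_counit B b.2)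
  rw [← ht, key, ht, Coalgebra.lTensor_counit_comul]
  simp

instance : ((augmentationIdeal B).restrictScalars ℂ).IsCoideal where
  counit_eq_zero := by
    intro x hx
    have hle : augmentation B * (⊤ : Submodule ℂ A) ≤
        LinearMap.ker (Coalgebra.counit (R := ℂ) (A := A)) := by
      refine Submodule.mul_le.2 fun m hm n _ => ?_
      have hm0 : Coalgebra.counit (R := ℂ) m = 0 := hm.2
      simp [hm0]
    exact hle hx
  map_mkQ_comul_eq_zero := by
    intro x hx
    let π := Ideal.Quotient.mkₐ ℂ (augmentationIdeal B)
    let F : A →ₐ[ℂ] (A ⧸ augmentationIdeal B) ⊗[ℂ] (A ⧸ augmentationIdeal B) :=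
      (Algebra.TensorProduct.map π π).comp (Bialgebra.comulAlgHom ℂ A)
    have hle : augmentation B * (⊤ : Submodule ℂ A) ≤ LinearMap.ker F.toLinearMap := by
      refine Submodule.mul_le.2 fun m hm n _ => ?_
      have h1 : F m = 0 := by
        have e1 : F m = π.toLinearMap.rTensor _ (π.toLinearMap.lTensor A
            (Coalgebra.comul (R := ℂ) m)) := by
          rw [← LinearMap.comp_apply, LinearMap.rTensor_comp_lTensor]; rfl
        have e2 : π.toLinearMap m = 0 :=
          Ideal.Quotient.eq_zero_iff_mem.2 (mem_augmentationIdeal_of_mem B hm.1 hm.2)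
        rw [e1, lTensor_mk_comul B hm.1, LinearMap.rTensor_tmul, e2, TensorProduct.zero_tmul]
      simp [h1]
    exact hle hx

instance : (augmentationIdeal B).IsHopfIdeal ℂ where
  antipode_mem := by
    intro x hx
    let π := Ideal.Quotient.mkₐ ℂ (augmentationIdeal B)
    have hle : augmentation B * (⊤ : Submodule ℂ A) ≤
        LinearMap.ker (π.toLinearMap ∘ₗ HopfAlgebra.antipode ℂ) := by
      refine Submodule.mul_le.2 fun m hm n _ => ?_
      have h1 : π (HopfAlgebra.antipode ℂ m) = 0 := by
        have h := congrArg π (HopfAlgebra.mul_antipode_rTensor_comul_apply (R := ℂ) m)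
        have e : ∀ t : A ⊗[ℂ] A, π (LinearMap.mul' ℂ A ((HopfAlgebra.antipode ℂ).rTensor A t)) =
            LinearMap.mul' ℂ _ ((π.toLinearMap ∘ₗ HopfAlgebra.antipode ℂ).rTensor _
              (π.toLinearMap.lTensor A t)) := by
          intro t
          induction t with
          | zero => simp
          | add x y hx hy => simp only [map_add, hx, hy]
          | tmul a b => simp
        have h0 : Coalgebra.counit (R := ℂ) m = 0 := hm.2
        rw [e, lTensor_mk_comul B hm.1, h0] at h
        simpa using h
      simp [HopfAlgebra.antipode_mul_antidistrib, h1]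
    exact Ideal.Quotient.eq_zero_iff_mem.1 (hle hx)

/-- The Hopf algebra `π_B(A) = A / B⁺A`. -/
def QuotientHopf : Type u := A ⧸ augmentationIdeal B

noncomputable instance : Ring (QuotientHopf B) :=
  inferInstanceAs (Ring (A ⧸ augmentationIdeal B))

noncomputable instance : HopfAlgebra ℂ (QuotientHopf B) :=
  inferInstanceAs (HopfAlgebra ℂ (A ⧸ augmentationIdeal B))

/-- The quotient map `π_B : A → A / B⁺A`, a map of bialgebras. -/
noncomputable def projBialgHom : A →ₐc[ℂ] QuotientHopf B :=
  Bialgebra.Quotient.mkBialgHom (R := ℂ) (augmentationIdeal B)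

/-- The quotient map `π_B : A → A / B⁺A`. -/
noncomputable def proj : A →ₐ[ℂ] QuotientHopf B := projBialgHom B

theorem proj_surjective : Function.Surjective (proj B) :=
  Ideal.Quotient.mk_surjective (I := augmentationIdeal B)

theorem proj_eq_zero_iff (a : A) : proj B a = 0 ↔ a ∈ augmentationIdeal B :=
  Ideal.Quotient.eq_zero_iff_mem

theorem lTensor_proj_comul {b : A} (hb : b ∈ B) :
    (proj B).toLinearMap.lTensor A (Coalgebra.comul (R := ℂ) b) =
      b ⊗ₜ[ℂ] (1 : QuotientHopf B) :=
  lTensor_mk_comul B hb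

/-- The left coaction `B → A ⊗ B`, the restriction of the coproduct of `A`. -/
noncomputable def leftCoaction : B →ₗ[ℂ] A ⊗[ℂ] B :=
  corestrict (Coalgebra.comul ∘ₗ B.val.toLinearMap) B.val.toLinearMap Subtype.val_injective
    fun b => hB.left_coideal b b.2

theorem lTensor_leftCoaction (b : B) :
    B.val.toLinearMap.lTensor A (leftCoaction B b) = Coalgebra.comul (R := ℂ) (b : A) :=
  lTensor_corestrict _ _ _ _ b

/-- The right `π_B(A)`-coaction `a ↦ a₁ ⊗ π_B(a₂)` on `A`. -/
noncomputable def rightCoaction : A →ₗ[ℂ] A ⊗[ℂ] QuotientHopf B :=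
  (proj B).toLinearMap.lTensor A ∘ₗ Coalgebra.comul

end Spaces

/-! ### Comodules and relative Hopf modules -/

/-- A left comodule over a complex coalgebra `C`. -/
structure LeftComodule (C : Type u) [AddCommGroup C] [Module ℂ C] [Coalgebra ℂ C] where
  carrier : Type u
  [addCommGroup : AddCommGroup carrier]
  [module : Module ℂ carrier]
  coaction : carrier →ₗ[ℂ] C ⊗[ℂ] carrier
  coassoc : ∀ v, TensorProduct.assoc ℂ C C carrier
      ((Coalgebra.comul (R := ℂ) (A := C)).rTensor carrier (coaction v)) =
    coaction.lTensor C (coaction v)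
  counit_coaction : ∀ v, TensorProduct.lid ℂ carrier
    ((Coalgebra.counit (R := ℂ) (A := C)).rTensor carrier (coaction v)) = v

attribute [instance] LeftComodule.addCommGroup LeftComodule.module

section RelHopf

variable {A : Type u} [Ring A] [HopfAlgebra ℂ A]

/-- The componentwise action of `A ⊗ B` on `A ⊗ M`: `(a ⊗ b)(a' ⊗ m) = a a' ⊗ b m`. -/
noncomputable def tensorAction (B : Subalgebra ℂ A) (M : Type u) [AddCommGroup M] [Module ℂ M]
    [Module B M] [IsScalarTower ℂ B M] :
    A ⊗[ℂ] B →ₗ[ℂ] A ⊗[ℂ] M →ₗ[ℂ] A ⊗[ℂ] M :=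
  TensorProduct.map₂ (LinearMap.mul ℂ A) (Algebra.lsmul ℂ ℂ M : B →ₐ[ℂ] _).toLinearMap

theorem lTensor_tensorAction (B : Subalgebra ℂ A) {M N : Type u}
    [AddCommGroup M] [Module ℂ M] [Module B M] [IsScalarTower ℂ B M]
    [AddCommGroup N] [Module ℂ N] [Module B N] [IsScalarTower ℂ B N]
    (ι : M →ₗ[ℂ] N) (hι : ∀ (b : B) m, ι (b • m) = b • ι m) (t : A ⊗[ℂ] B) (x : A ⊗[ℂ] M) :
    ι.lTensor A (tensorAction B M t x) = tensorAction B N t (ι.lTensor A x) := by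
  induction t with
  | zero => simp
  | add s t hs ht => simp only [map_add, LinearMap.add_apply, hs, ht]
  | tmul a b =>
    induction x with
    | zero => simp
    | add x y hx hy => simp only [map_add, hx, hy]
    | tmul a' m => simp [tensorAction, hι]

theorem tensorAction_self (B : Subalgebra ℂ A) (t : A ⊗[ℂ] B) (x : A ⊗[ℂ] A) :
    tensorAction B A t x = B.val.toLinearMap.lTensor A t * x := by
  induction t with
  | zero => simp
  | add s t hs ht => simp only [map_add, LinearMap.add_apply, add_mul, hs, ht]
  | tmul a b =>
    induction x with
    | zero => simp
    | add x y hx hy => simp only [map_add, mul_add, hx, hy]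
    | tmul a' m => simp [tensorAction, Subalgebra.smul_def]

/-- A relative Hopf module, that is, an object of `^A_B Mod`: a left `A`-comodule and left
`B`-module `M` such that the coaction satisfies `Δ_L(b m) = Δ_L(b) Δ_L(m)`. -/
structure RelHopfModule (B : Subalgebra ℂ A) [IsQuantumHomogeneousSpace B]
    extends LeftComodule A where
  [moduleB : Module B carrier]
  [isScalarTower : IsScalarTower ℂ B carrier]
  coaction_smul : ∀ (b : B) (m : carrier),
    coaction (b • m) = tensorAction B carrier (leftCoaction B b) (coaction m)

attribute [instance] RelHopfModule.moduleB RelHopfModule.isScalarTower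

variable {B : Subalgebra ℂ A} [IsQuantumHomogeneousSpace B]

/-- Morphisms of relative Hopf modules: left `B`-module maps which are left `A`-comodule maps. -/
@[ext] structure RelHopfModule.Hom (M N : RelHopfModule B) where
  toLinearMap : M.carrier →ₗ[B] N.carrier
  coaction_comm : ∀ m, N.coaction (toLinearMap m) =
    (toLinearMap.restrictScalars ℂ).lTensor A (M.coaction m)

instance : Category (RelHopfModule B) where
  Hom := RelHopfModule.Hom
  id M := ⟨LinearMap.id, fun m => by
    have : (LinearMap.id : M.carrier →ₗ[B] M.carrier).restrictScalars ℂ = LinearMap.id := rfl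
    rw [this]; simp⟩
  comp {M N K} f g := ⟨g.toLinearMap ∘ₗ f.toLinearMap, fun m => by
    have : (g.toLinearMap ∘ₗ f.toLinearMap).restrictScalars ℂ =
      g.toLinearMap.restrictScalars ℂ ∘ₗ f.toLinearMap.restrictScalars ℂ := rfl
    rw [this, LinearMap.lTensor_comp, LinearMap.comp_apply, LinearMap.comp_apply,
      g.coaction_comm, f.coaction_comm]⟩

end RelHopf

/-! ### The relative Hopf modules of a nested pair -/

section Nested

variable {A : Type u} [Ring A] [HopfAlgebra ℂ A]
variable (B P : Subalgebra ℂ A) [hB : IsQuantumHomogeneousSpace B]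
  [hP : IsQuantumHomogeneousSpace P]

/-- `P ⊇ B` as an object of `^A_B Mod`: `B` acts by left multiplication, and the coaction is the
restriction of the coproduct. -/
noncomputable def nestedObject (h : B ≤ P) : RelHopfModule B :=
  letI : Module B P := Module.compHom P (Subalgebra.inclusion h).toRingHom
  haveI : IsScalarTower ℂ B P := ⟨fun c b p => Subtype.ext (smul_mul_assoc c (b : A) (p : A))⟩
  { carrier := P
    coaction := leftCoaction P
    coassoc := coassoc_of_injective P.val.toLinearMap Subtype.val_injective
      Coalgebra.comul (leftCoaction P) (lTensor_leftCoaction P)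
      fun v => Coalgebra.coassoc_apply v
    counit_coaction := counit_of_injective P.val.toLinearMap Subtype.val_injective
      Coalgebra.comul (leftCoaction P) (lTensor_leftCoaction P)
      fun v => by rw [Coalgebra.rTensor_counit_comul]; simp
    coaction_smul := fun b p => by
      apply lTensor_inj A P.val.toLinearMap Subtype.val_injective
      rw [lTensor_tensorAction B P.val.toLinearMap (fun _ _ => rfl), tensorAction_self,
        lTensor_leftCoaction, lTensor_leftCoaction, lTensor_leftCoaction, ← Bialgebra.comul_mul]
      rfl }

theorem rightCoaction_mul {b : A} (hb : b ∈ B) (a : A) :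
    rightCoaction B (b * a) = (b ⊗ₜ[ℂ] (1 : QuotientHopf B)) * rightCoaction B a := by
  have e : ∀ s t : A ⊗[ℂ] A, (proj B).toLinearMap.lTensor A (s * t) =
      (proj B).toLinearMap.lTensor A s * (proj B).toLinearMap.lTensor A t :=
    map_mul (Algebra.TensorProduct.map (AlgHom.id ℂ A) (proj B))
  simp only [rightCoaction, LinearMap.comp_apply, Bialgebra.comul_mul]
  rw [e, lTensor_proj_comul B hb]

variable {B} in
/-- The linear map `A ⊗ V → A ⊗ π_B(A) ⊗ V`, `Δ_R ⊗ id - id ⊗ Δ_L`, whose kernel is the cotensor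
product. -/
noncomputable def cotensorMap (V : LeftComodule (QuotientHopf B)) :
    A ⊗[ℂ] V.carrier →ₗ[ℂ] A ⊗[ℂ] (QuotientHopf B ⊗[ℂ] V.carrier) :=
  (TensorProduct.assoc ℂ A (QuotientHopf B) V.carrier).toLinearMap ∘ₗ
    (rightCoaction B).rTensor V.carrier - V.coaction.lTensor A

theorem cotensorMap_smul (V : LeftComodule (QuotientHopf B)) (b : B) (x : A ⊗[ℂ] V.carrier) :
    cotensorMap V (b • x) = b • cotensorMap V x := by
  induction x with
  | zero => simp
  | add x y hx hy => simp only [map_add, smul_add, hx, hy]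
  | tmul a v =>
    have hba : b • a ⊗ₜ[ℂ] v = ((b : A) * a) ⊗ₜ[ℂ] v := rfl
    rw [hba]
    simp only [cotensorMap, LinearMap.sub_apply, LinearMap.comp_apply, LinearMap.rTensor_tmul,
      LinearMap.lTensor_tmul, smul_sub, LinearEquiv.coe_coe, rightCoaction_mul B b.2]
    congr 1
    induction rightCoaction B a with
    | zero => simp
    | add x y hx hy => simp only [mul_add, map_add, TensorProduct.add_tmul, smul_add, hx, hy]
    | tmul a' c =>
      rw [Algebra.TensorProduct.tmul_mul_tmul, one_mul, TensorProduct.assoc_tmul,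
        TensorProduct.assoc_tmul]
      rfl

variable {B} in
/-- The cotensor product `A □_{π_B} V ⊆ A ⊗ V`. -/
noncomputable def cotensorProduct (V : LeftComodule (QuotientHopf B)) :
    Submodule ℂ (A ⊗[ℂ] V.carrier) where
  carrier := {x | TensorProduct.assoc ℂ A (QuotientHopf B) V.carrier
    ((rightCoaction B).rTensor V.carrier x) = V.coaction.lTensor A x}
  add_mem' {x y} hx hy := by
    simp only [Set.mem_ofPred_eq, map_add] at hx hy ⊢
    rw [hx, hy]
  zero_mem' := by simp
  smul_mem' c x hx := by
    simp only [Set.mem_ofPred_eq, map_smul] at hx ⊢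
    rw [hx]

variable {B} in
theorem mem_cotensorProduct (V : LeftComodule (QuotientHopf B)) (x : A ⊗[ℂ] V.carrier) :
    x ∈ cotensorProduct V ↔ cotensorMap V x = 0 :=
  (sub_eq_zero (a := TensorProduct.assoc ℂ A (QuotientHopf B) V.carrier
    ((rightCoaction B).rTensor V.carrier x)) (b := V.coaction.lTensor A x)).symm

variable {B} in
/-- The cotensor product `A □_{π_B} V` as a type. -/
def Cotensor (V : LeftComodule (QuotientHopf B)) : Type u := cotensorProduct V

noncomputable instance (V : LeftComodule (QuotientHopf B)) : AddCommGroup (Cotensor V) :=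
  inferInstanceAs (AddCommGroup (cotensorProduct V))

noncomputable instance (V : LeftComodule (QuotientHopf B)) : Module ℂ (Cotensor V) :=
  inferInstanceAs (Module ℂ (cotensorProduct V))

variable {B} in
/-- The inclusion `A □_{π_B} V → A ⊗ V`. -/
noncomputable def cotensorInclusion (V : LeftComodule (QuotientHopf B)) :
    Cotensor V →ₗ[ℂ] A ⊗[ℂ] V.carrier where
  toFun x := x.1
  map_add' _ _ := rfl
  map_smul' _ _ := rfl

variable {B} in
theorem cotensorInclusion_injective (V : LeftComodule (QuotientHopf B)) :
    Function.Injective (cotensorInclusion V) := fun _ _ h => Subtype.ext h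

variable {B} in
theorem cotensor_exact (V : LeftComodule (QuotientHopf B)) :
    Function.Exact (cotensorInclusion V) (cotensorMap V) := fun y =>
  ⟨fun hy => ⟨⟨y, (mem_cotensorProduct V y).2 hy⟩, rfl⟩, by
    rintro ⟨z, rfl⟩
    exact (mem_cotensorProduct V _).1 z.2⟩

/-- `B` acts on `A □_{π_B} V` by left multiplication on the first tensor factor. -/
noncomputable instance (V : LeftComodule (QuotientHopf B)) : SMul B (Cotensor V) where
  smul b x := ⟨b • cotensorInclusion V x, by
    rw [mem_cotensorProduct, cotensorMap_smul, (cotensor_exact V).apply_apply_eq_zero,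
      smul_zero]⟩

noncomputable instance (V : LeftComodule (QuotientHopf B)) : Module B (Cotensor V) :=
  Function.Injective.module B (cotensorInclusion V).toAddMonoidHom
    (cotensorInclusion_injective V) fun _ _ => rfl

theorem cotensorInclusion_smul (V : LeftComodule (QuotientHopf B)) (b : B) (x : Cotensor V) :
    cotensorInclusion V (b • x) = b • cotensorInclusion V x := rfl

instance (V : LeftComodule (QuotientHopf B)) : IsScalarTower ℂ B (Cotensor V) where
  smul_assoc c b x := cotensorInclusion_injective V (smul_assoc c b (cotensorInclusion V x))

variable {B} in
theorem cotensorMap_comulLeft (V : LeftComodule (QuotientHopf B)) (x : A ⊗[ℂ] V.carrier) :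
    (cotensorMap V).lTensor A (comulLeft A V.carrier x) =
      comulLeft A (QuotientHopf B ⊗[ℂ] V.carrier) (cotensorMap V x) := by
  induction x with
  | zero => simp
  | add x y hx hy => simp only [map_add, hx, hy]
  | tmul a v =>
    have e1 : ∀ c : A, cotensorMap V (c ⊗ₜ v) =
        (TensorProduct.assoc ℂ A (QuotientHopf B) V.carrier) (rightCoaction B c ⊗ₜ v) -
          c ⊗ₜ V.coaction v := fun c => by
      simp [cotensorMap]
    have e2 : cotensorMap V ∘ₗ (TensorProduct.mk ℂ A V.carrier).flip v =
        (((TensorProduct.mk ℂ (QuotientHopf B) V.carrier).flip v).lTensor A ∘ₗ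
          (proj B).toLinearMap.lTensor A) ∘ₗ Coalgebra.comul (R := ℂ) -
        (TensorProduct.mk ℂ A _).flip (V.coaction v) := by
      ext c
      simp only [LinearMap.comp_apply, LinearMap.flip_apply, TensorProduct.mk_apply, e1,
        LinearMap.sub_apply, rightCoaction]
      congr 1
      induction Coalgebra.comul (R := ℂ) c with
      | zero => simp
      | add x y hx hy => simp only [map_add, TensorProduct.add_tmul, hx, hy]
      | tmul a b => simp
    have e3 : ∀ t : A ⊗[ℂ] A, comulLeft A (QuotientHopf B ⊗[ℂ] V.carrier)
        (((TensorProduct.mk ℂ (QuotientHopf B) V.carrier).flip v).lTensor A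
          ((proj B).toLinearMap.lTensor A t)) =
        (((TensorProduct.mk ℂ (QuotientHopf B) V.carrier).flip v).lTensor A ∘ₗ
          (proj B).toLinearMap.lTensor A).lTensor A
          (TensorProduct.assoc ℂ A A A ((Coalgebra.comul (R := ℂ) (A := A)).rTensor A t)) := by
      intro t
      induction t with
      | zero => simp
      | add x y hx hy => simp only [map_add, hx, hy]
      | tmul a b =>
        simp only [LinearMap.rTensor_tmul, LinearMap.lTensor_tmul, comulLeft_tmul]
        induction Coalgebra.comul (R := ℂ) a with
        | zero => simp
        | add x y hx hy => simp only [map_add, TensorProduct.add_tmul, hx, hy]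
        | tmul a b => simp
    have e4 : cotensorMap V (a ⊗ₜ v) =
        ((TensorProduct.mk ℂ (QuotientHopf B) V.carrier).flip v).lTensor A
          ((proj B).toLinearMap.lTensor A (Coalgebra.comul (R := ℂ) a)) -
        a ⊗ₜ V.coaction v := LinearMap.congr_fun e2 a
    rw [comulLeft_tmul, ← LinearMap.comp_apply, ← LinearMap.lTensor_comp, e2,
      LinearMap.lTensor_sub, LinearMap.sub_apply, LinearMap.lTensor_comp, LinearMap.comp_apply,
      e4, map_sub, e3, comulLeft_tmul, Coalgebra.coassoc_apply]

variable {B} in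
theorem comulLeft_mem (V : LeftComodule (QuotientHopf B)) (x : Cotensor V) :
    (comulLeft A V.carrier ∘ₗ cotensorInclusion V) x ∈
      LinearMap.range ((cotensorInclusion V).lTensor A) := by
  refine mem_range_lTensor_of_ker (cotensorMap V) (cotensorInclusion V) (cotensor_exact V) _ ?_
  rw [LinearMap.comp_apply, cotensorMap_comulLeft, (cotensor_exact V).apply_apply_eq_zero, map_zero]

theorem comulLeft_smul (V : Type u) [AddCommGroup V] [Module ℂ V] (b : B) (x : A ⊗[ℂ] V) :
    comulLeft A V (b • x) = tensorAction B (A ⊗[ℂ] V) (leftCoaction B b) (comulLeft A V x) := by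
  induction x with
  | zero => simp
  | add x y hx hy => simp only [map_add, smul_add, hx, hy]
  | tmul a v =>
    have hba : b • a ⊗ₜ[ℂ] v = ((b : A) * a) ⊗ₜ[ℂ] v := rfl
    rw [hba, comulLeft_tmul, comulLeft_tmul, Bialgebra.comul_mul, ← lTensor_leftCoaction, ← tensorAction_self,
      lTensor_tensorAction]
    exact fun _ _ => rfl

variable {B} in
/-- The left `A`-coaction on `A □_{π_B} V`, given by the coproduct of the first tensor factor. -/
noncomputable def cotensorCoaction (V : LeftComodule (QuotientHopf B)) :
    Cotensor V →ₗ[ℂ] A ⊗[ℂ] Cotensor V :=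
  corestrict (comulLeft A V.carrier ∘ₗ cotensorInclusion V) (cotensorInclusion V)
    (cotensorInclusion_injective V) (comulLeft_mem V)

variable {B} in
theorem lTensor_cotensorCoaction (V : LeftComodule (QuotientHopf B)) (x : Cotensor V) :
    (cotensorInclusion V).lTensor A (cotensorCoaction V x) =
      comulLeft A V.carrier (cotensorInclusion V x) :=
  lTensor_corestrict (comulLeft A V.carrier ∘ₗ cotensorInclusion V) (cotensorInclusion V)
    (cotensorInclusion_injective V) (comulLeft_mem V) x

variable {B} in
/-- The object `Ψ(V) = A □_{π_B} V` of `^A_B Mod`, for a left `π_B(A)`-comodule `V`; the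
`A`-coaction is the coproduct of the first tensor factor. -/
noncomputable def cotensorObject (V : LeftComodule (QuotientHopf B)) : RelHopfModule B where
  carrier := Cotensor V
  coaction := cotensorCoaction V
  coassoc := coassoc_of_injective (cotensorInclusion V) (cotensorInclusion_injective V)
    (comulLeft A V.carrier) (cotensorCoaction V) (lTensor_cotensorCoaction V) comulLeft_coassoc
  counit_coaction := counit_of_injective (cotensorInclusion V) (cotensorInclusion_injective V)
    (comulLeft A V.carrier) (cotensorCoaction V) (lTensor_cotensorCoaction V) comulLeft_counit
  coaction_smul := fun b x => by
    apply lTensor_inj A (cotensorInclusion V) (cotensorInclusion_injective V)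
    rw [lTensor_tensorAction B (cotensorInclusion V) (cotensorInclusion_smul B V),
      lTensor_cotensorCoaction, lTensor_cotensorCoaction, cotensorInclusion_smul, comulLeft_smul]

theorem augmentationIdeal_mono (h : B ≤ P) : augmentationIdeal B ≤ augmentationIdeal P :=
  fun _ hx => mul_mem_mono (inf_le_inf_right _ (Subalgebra.toSubmodule.monotone h)) le_rfl hx

/-- The Hopf algebra map `π_{B,P} : π_B(A) → π_P(A)`, `π_B(a) ↦ π_P(a)`. -/
noncomputable def projNested (h : B ≤ P) : QuotientHopf B →ₐ[ℂ] QuotientHopf P :=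
  (Ideal.Quotient.factorₐ ℂ (augmentationIdeal_mono B P h) :
    A ⧸ augmentationIdeal B →ₐ[ℂ] A ⧸ augmentationIdeal P)

theorem projNested_proj (h : B ≤ P) (a : A) : projNested B P h (proj B a) = proj P a := rfl

/-- The space `π_B(A)^{co(π_P(A))}` of coinvariants of the right `π_P(A)`-coaction
`(id ⊗ π_{B,P}) ∘ Δ` on `π_B(A)`. -/
noncomputable def coinvariants (h : B ≤ P) : Submodule ℂ (QuotientHopf B) where
  carrier := {x | (projNested B P h).toLinearMap.lTensor (QuotientHopf B)
    (Coalgebra.comul (R := ℂ) x) = x ⊗ₜ[ℂ] (1 : QuotientHopf P)}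
  add_mem' {x y} hx hy := by
    simp only [Set.mem_ofPred_eq, map_add] at hx hy ⊢
    rw [hx, hy, TensorProduct.add_tmul]
  zero_mem' := by simp
  smul_mem' c x hx := by
    simp only [Set.mem_ofPred_eq, map_smul] at hx ⊢
    rw [hx, TensorProduct.smul_tmul']

theorem comul_mem_of_coinvariants (h : B ≤ P) (x : coinvariants B P h) :
    Coalgebra.comul (R := ℂ) (x : QuotientHopf B) ∈
      LinearMap.range ((coinvariants B P h).subtype.lTensor (QuotientHopf B)) := by
  let q := (projNested B P h).toLinearMap
  let r : QuotientHopf B →ₗ[ℂ] QuotientHopf B ⊗[ℂ] QuotientHopf P :=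
    (TensorProduct.mk ℂ (QuotientHopf B) (QuotientHopf P)).flip 1
  let θ := q.lTensor (QuotientHopf B) ∘ₗ Coalgebra.comul (R := ℂ) - r
  refine mem_range_lTensor_of_ker θ _ (fun y => ?_) _ ?_
  · constructor
    · intro hy
      exact ⟨⟨y, sub_eq_zero.1 hy⟩, rfl⟩
    · rintro ⟨z, rfl⟩
      exact sub_eq_zero.2 z.2
  · have hx : q.lTensor (QuotientHopf B) (Coalgebra.comul (R := ℂ) (x : QuotientHopf B)) =
        (x : QuotientHopf B) ⊗ₜ[ℂ] (1 : QuotientHopf P) := x.2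
    have e : ∀ t : QuotientHopf B ⊗[ℂ] QuotientHopf B,
        (q.lTensor (QuotientHopf B)).lTensor (QuotientHopf B)
          (TensorProduct.assoc ℂ _ _ _ ((Coalgebra.comul (R := ℂ)).rTensor _ t)) =
        comulLeft _ _ (q.lTensor (QuotientHopf B) t) := by
      intro t
      induction t with
      | zero => simp
      | add x y hx hy => simp only [map_add, hx, hy]
      | tmul a b =>
        simp only [LinearMap.rTensor_tmul, LinearMap.lTensor_tmul, comulLeft_tmul]
        induction Coalgebra.comul (R := ℂ) a with
        | zero => simp
        | add x y hx hy => simp only [map_add, TensorProduct.add_tmul, hx, hy]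
        | tmul a b => simp
    rw [LinearMap.lTensor_sub, LinearMap.sub_apply, LinearMap.lTensor_comp, LinearMap.comp_apply,
      ← Coalgebra.coassoc_apply, e, hx, comulLeft_tmul, sub_self]

/-- `π_B(A)^{co(π_P(A))}` as a left `π_B(A)`-comodule, a subcomodule of `π_B(A)`. -/
noncomputable def fiber (h : B ≤ P) : LeftComodule (QuotientHopf B) where
  carrier := coinvariants B P h
  coaction := corestrict (Coalgebra.comul ∘ₗ (coinvariants B P h).subtype)
    (coinvariants B P h).subtype Subtype.val_injective (comul_mem_of_coinvariants B P h)
  coassoc := coassoc_of_injective (coinvariants B P h).subtype Subtype.val_injective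
    Coalgebra.comul _ (lTensor_corestrict _ _ _ _) fun v => Coalgebra.coassoc_apply v
  counit_coaction := counit_of_injective (coinvariants B P h).subtype Subtype.val_injective
    Coalgebra.comul _ (lTensor_corestrict _ _ _ _)
    fun v => by rw [Coalgebra.rTensor_counit_comul]; simp

end Nested

end QHS

/-! The engine is the class of S(a₁) ⊗ a₂ in A ⊗_B A. Since Δ(B) ⊆ A ⊗ B, replacing a by ba with b ∈
B only multiplies it by S(b₁)b₂ = ε(b), so it depends on π_B(a) alone. Hence a ⊗ π_B(a') ↦ aS(a'₁) ⊗
a'₂ is well defined into A ⊗_B A and undoes the canonical map a ⊗ a' ↦ aa'₁ ⊗ π_B(a'₂).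

With P in place of B, this makes P → A → A ⊗ π_P(A), with second map a ↦ a₁ ⊗ π_P(a₂) - a ⊗ 1, exact
after A ⊗_P -. Faithful flatness over P reflects exactness, so P is the space of π_P(A)-coinvariants
of A (`rightCoaction_eq_tmul_one_iff`).

For (2), let π_B(a) be coinvariant. The class of S(a₁) ⊗ a₂ is then killed by id ⊗_B (a ↦ a₁ ⊗
π_P(a₂) - a ⊗ 1) (`map_coactionDefect_antipodeComul`), so flatness over B brings it from A ⊗_B P.
Applying ε ⊗ π_B, which sends it to π_B(a), gives π_B(a) ∈ π_B(P).

For (1), a ↦ a₁ ⊗ π_B(a₂) identifies A with A □ π_B(A), with inverse id ⊗ ε. It remains to see which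
a land in A ⊗ π_B(A)^co. There π_{B,P} acts as v ↦ ε(v)1, so id ⊗ π_{B,P} turns this condition into
a₁ ⊗ π_P(a₂) = a ⊗ 1, that is, a ∈ P. -/

namespace QHS

/-! ### The class of S(a₁) ⊗ a₂ in A ⊗_B A and the inverse of the canonical map. -/

section Balanced

variable {A : Type u} [Ring A] [HopfAlgebra ℂ A]

/-- The map `a ↦ S(a₁) ⊗ a₂`. -/
noncomputable def antipodeComul (A : Type u) [Ring A] [HopfAlgebra ℂ A] : A →ₗ[ℂ] A ⊗[ℂ] A :=
  (HopfAlgebra.antipode ℂ).rTensor A ∘ₗ Coalgebra.comul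

/-- The antipode reverses products: S(xy) ⊗ qz = S(y)S(x) ⊗ qz, and q ∈ B can be moved across the
balanced tensor sign to give S(y)S(x)q ⊗ z. The intended t is Δ(b), where S(x)q becomes ε(b). -/
theorem rTensor_antipode_mul (B : Subalgebra ℂ A) (t : A ⊗[ℂ] B) (s : A ⊗[ℂ] A) :
    (HopfAlgebra.antipode ℂ).rTensor A (B.val.toLinearMap.lTensor A t * s) -
      (HopfAlgebra.antipode ℂ).rTensor A s *
        (LinearMap.mul' ℂ A ((HopfAlgebra.antipode ℂ).rTensor A
          (B.val.toLinearMap.lTensor A t)) ⊗ₜ[ℂ] 1) ∈ balancedRelations B A := by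
  induction t with
  | zero => simp
  | add x y hx hy =>
    simp only [map_add, add_mul, mul_add, TensorProduct.add_tmul]
    convert Submodule.add_mem _ hx hy using 1
    abel
  | tmul x q =>
    induction s with
    | zero => simp
    | add x y hx hy =>
      simp only [map_add, add_mul, mul_add]
      convert Submodule.add_mem _ hx hy using 1
      abel
    | tmul y z =>
      -- The defining relations have the opposite sign, ab ⊗ m - a ⊗ bm.
      rw [← neg_mem_iff]
      refine Submodule.subset_span ⟨HopfAlgebra.antipode ℂ y * HopfAlgebra.antipode ℂ x, q, z, ?_⟩
      simp [HopfAlgebra.antipode_mul_antidistrib, Subalgebra.smul_def, mul_assoc]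

/-- For b ∈ B⁺ the factor S(b₁)b₂ = ε(b) vanishes. Consequently S(a₁) ⊗ a₂, read in A ⊗_B A, depends
only on π_B(a). -/
theorem antipodeComul_mem_balancedRelations (B : Subalgebra ℂ A) [hB : IsQuantumHomogeneousSpace B]
    {a : A} (ha : a ∈ augmentationIdeal B) : antipodeComul A a ∈ balancedRelations B A := by
  have hle : augmentation B * (⊤ : Submodule ℂ A) ≤
      (balancedRelations B A).comap (antipodeComul A) := by
    refine Submodule.mul_le.2 fun b hb a _ => ?_
    obtain ⟨t, ht⟩ := hB.left_coideal b hb.1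
    have h0 : Coalgebra.counit (R := ℂ) b = 0 := hb.2
    have h := rTensor_antipode_mul B t (Coalgebra.comul (R := ℂ) a)
    rw [ht, HopfAlgebra.mul_antipode_rTensor_comul_apply, h0, map_zero, TensorProduct.zero_tmul,
      mul_zero, sub_zero, ← Bialgebra.comul_mul] at h
    exact h
  exact hle ha

theorem tmul_one_mul_mem_balancedRelations (B : Subalgebra ℂ A) (a : A) {x : A ⊗[ℂ] A}
    (hx : x ∈ balancedRelations B A) : (a ⊗ₜ[ℂ] 1) * x ∈ balancedRelations B A := by
  have hle : balancedRelations B A ≤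
      (balancedRelations B A).comap (LinearMap.mulLeft ℂ (a ⊗ₜ[ℂ] (1 : A))) := by
    refine Submodule.span_le.2 ?_
    rintro _ ⟨c, b, m, rfl⟩
    refine Submodule.subset_span ⟨a * c, b, m, ?_⟩
    simp [mul_sub, mul_assoc]
  exact hle hx

/-- The map `a ⊗ a' ↦ a S(a'₁) ⊗ a'₂`. -/
noncomputable def shear (A : Type u) [Ring A] [HopfAlgebra ℂ A] : A ⊗[ℂ] A →ₗ[ℂ] A ⊗[ℂ] A :=
  TensorProduct.lift ((LinearMap.mul ℂ (A ⊗[ℂ] A)).compl₁₂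
    ((TensorProduct.mk ℂ A A).flip 1) (antipodeComul A))

theorem shear_tmul (a a' : A) : shear A (a ⊗ₜ a') = (a ⊗ₜ 1) * antipodeComul A a' := rfl

theorem shear_tmul_one_mul (a : A) (s : A ⊗[ℂ] A) :
    shear A ((a ⊗ₜ 1) * s) = (a ⊗ₜ 1) * shear A s := by
  induction s with
  | zero => simp
  | add x y hx hy => simp only [map_add, mul_add, hx, hy]
  | tmul x y => simp [shear_tmul, ← mul_assoc]

/-- By coassociativity the left side is a₁S(a₂) ⊗ a₃. With left A-linearity this says that `shear`
undoes a ⊗ a' ↦ aa'₁ ⊗ a'₂. -/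
theorem shear_comul (a : A) : shear A (Coalgebra.comul (R := ℂ) a) = 1 ⊗ₜ a := by
  have e1 : ∀ s : A ⊗[ℂ] A, shear A s = ((LinearMap.mul' ℂ A ∘ₗ
      (HopfAlgebra.antipode ℂ).lTensor A).rTensor A) ((TensorProduct.assoc ℂ A A A).symm
        ((Coalgebra.comul (R := ℂ) (A := A)).lTensor A s)) := by
    intro s
    induction s with
    | zero => simp
    | add x y hx hy => simp only [map_add, hx, hy]
    | tmul x y =>
      simp only [shear_tmul, antipodeComul, LinearMap.comp_apply, LinearMap.lTensor_tmul]
      induction Coalgebra.comul (R := ℂ) y with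
      | zero => simp
      | add x y hx hy => simp only [map_add, mul_add, TensorProduct.tmul_add, hx, hy]
      | tmul z w => simp
  have e2 : (LinearMap.mul' ℂ A ∘ₗ (HopfAlgebra.antipode ℂ).lTensor A) ∘ₗ Coalgebra.comul =
      Algebra.linearMap ℂ A ∘ₗ Coalgebra.counit := by
    rw [LinearMap.comp_assoc]; exact HopfAlgebra.mul_antipode_lTensor_comul
  rw [e1, Coalgebra.coassoc_symm_apply, ← LinearMap.comp_apply, ← LinearMap.rTensor_comp, e2,
    LinearMap.rTensor_comp, LinearMap.comp_apply, Coalgebra.rTensor_counit_comul]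
  simp

/-- Over a field the kernel of id ⊗ π_B is A ⊗ B⁺A. So `shear` descends to a map A ⊗ π_B(A) → A ⊗_B
A. -/
theorem shear_mem_balancedRelations (B : Subalgebra ℂ A) [IsQuantumHomogeneousSpace B]
    {w : A ⊗[ℂ] A} (hw : (proj B).toLinearMap.lTensor A w = 0) :
    shear A w ∈ balancedRelations B A := by
  obtain ⟨s, rfl⟩ := mem_range_lTensor_of_ker (proj B).toLinearMap
    (LinearMap.ker (proj B).toLinearMap).subtype (LinearMap.exact_subtype_ker_map _) w hw
  induction s with
  | zero => simp
  | add x y hx hy =>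
    simp only [map_add]
    refine add_mem (hx ?_) (hy ?_) <;>
      rw [← LinearMap.comp_apply, ← LinearMap.lTensor_comp, LinearMap.comp_ker_subtype] <;> simp
  | tmul a k =>
    exact tmul_one_mul_mem_balancedRelations B a
      (antipodeComul_mem_balancedRelations B ((proj_eq_zero_iff B _).1 k.2))

/-- The multiplication `A ⊗_B (A ⊗ D) → A ⊗ D`. -/
noncomputable def mulOver (B : Subalgebra ℂ A) (D : Type u) [AddCommGroup D] [Module ℂ D] :
    TensorOver B (A ⊗[ℂ] D) →ₗ[ℂ] A ⊗[ℂ] D :=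
  Submodule.liftQ _ ((LinearMap.mul' ℂ A).rTensor D ∘ₗ
    (TensorProduct.assoc ℂ A A D).symm.toLinearMap) <| by
    refine Submodule.span_le.2 ?_
    rintro _ ⟨a, b, m, rfl⟩
    simp only [SetLike.mem_coe, LinearMap.mem_ker]
    induction m with
    | zero => simp
    | add x y hx hy =>
      -- The right side is split as 0 + 0, and each zero is replaced by the left side of an
      -- induction hypothesis.
      rw [← add_zero (0 : A ⊗[ℂ] D)]
      nth_rw 1 [← hx]
      rw [← hy, ← map_add]
      simp only [TensorProduct.tmul_add, smul_add]
      congr 1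
      abel
    | tmul x d => simp [TensorProduct.smul_tmul', Subalgebra.smul_def, mul_assoc]

end Balanced

/-! ### P as the coinvariants of A under π_P(A). -/

section Coinvariants

variable {A : Type u} [Ring A] [HopfAlgebra ℂ A]
variable (B P : Subalgebra ℂ A) [hP : IsQuantumHomogeneousSpace P]

/-- The left `B`-linear map `a ↦ a₁ ⊗ π_P(a₂) - a ⊗ 1`, for `B ⊆ P`. -/
noncomputable def coactionDefect (h : B ≤ P) : A →ₗ[B] A ⊗[ℂ] QuotientHopf P where
  toFun a := rightCoaction P a - a ⊗ₜ 1
  map_add' x y := by simp only [map_add, TensorProduct.add_tmul]; abel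
  map_smul' b x := by
    have e : ∀ t : A ⊗[ℂ] QuotientHopf P, ((b : A) ⊗ₜ[ℂ] (1 : QuotientHopf P)) * t = b • t := by
      intro t
      induction t with
      | zero => simp
      | add x y hx hy => simp only [mul_add, smul_add, hx, hy]
      | tmul x y => simp [TensorProduct.smul_tmul', Subalgebra.smul_def]
    rw [Subalgebra.smul_def, smul_eq_mul, rightCoaction_mul P (h b.2), e, smul_sub]
    rfl

theorem coactionDefect_apply (h : B ≤ P) (a : A) :
    coactionDefect B P h a = rightCoaction P a - a ⊗ₜ 1 := rfl

theorem coactionDefect_eq_lTensor (h : B ≤ P) (a : A) :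
    coactionDefect B P h a =
      (proj P).toLinearMap.lTensor A (Coalgebra.comul (R := ℂ) a - a ⊗ₜ 1) := by
  simp [coactionDefect_apply, rightCoaction]

/-- Both sides are S(a₁) ⊗ (a₂ ⊗ π_P(a₃) - a₂ ⊗ 1), by coassociativity. The right side exposes the
defect of a itself, about which coinvariance of π_B(a) gives information. -/
theorem lTensor_coactionDefect_antipodeComul (h : B ≤ P) (a : A) :
    ((coactionDefect B P h).restrictScalars ℂ).lTensor A (antipodeComul A a) =
      TensorProduct.assoc ℂ A A _ ((antipodeComul A).rTensor _ (coactionDefect B P h a)) := by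
  have e1 : ∀ s : A ⊗[ℂ] A, ((coactionDefect B P h).restrictScalars ℂ).lTensor A s =
      ((proj P).toLinearMap.lTensor A).lTensor A
        ((Coalgebra.comul (R := ℂ) (A := A)).lTensor A s) - TensorProduct.assoc ℂ A A _ (s ⊗ₜ 1) := by
    intro s
    induction s with
    | zero => simp
    | add x y hx hy => simp only [map_add, TensorProduct.add_tmul, hx, hy]; abel
    | tmul x y => simp [coactionDefect_apply, rightCoaction, TensorProduct.tmul_sub]
  have e2 : ∀ s : A ⊗[ℂ] A, TensorProduct.assoc ℂ A A _ ((antipodeComul A).rTensor _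
      ((proj P).toLinearMap.lTensor A s)) = ((proj P).toLinearMap.lTensor A).lTensor A
        ((HopfAlgebra.antipode ℂ).rTensor _ (TensorProduct.assoc ℂ A A A
          ((Coalgebra.comul (R := ℂ) (A := A)).rTensor A s))) := by
    intro s
    induction s with
    | zero => simp
    | add x y hx hy => simp only [map_add, hx, hy]
    | tmul x y =>
      simp only [antipodeComul, LinearMap.rTensor_tmul, LinearMap.lTensor_tmul,
        LinearMap.comp_apply]
      induction Coalgebra.comul (R := ℂ) x with
      | zero => simp
      | add x y hx hy => simp only [map_add, TensorProduct.add_tmul, hx, hy]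
      | tmul z w => simp
  rw [e1, coactionDefect_apply, map_sub, map_sub, rightCoaction, LinearMap.comp_apply, e2,
    Coalgebra.coassoc_apply, LinearMap.rTensor_tmul]
  congr 2
  rw [antipodeComul, LinearMap.comp_apply, ← LinearMap.comp_apply, ← LinearMap.comp_apply,
    LinearMap.lTensor_comp_rTensor, ← LinearMap.rTensor_comp_lTensor]
  rfl

/-- The inclusion `P → A` as a left `P`-linear map. -/
def inclusionLinear (P : Subalgebra ℂ A) : P →ₗ[P] A where
  toFun := Subtype.val
  map_add' _ _ := rfl
  map_smul' _ _ := rfl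

/-- A quantum homogeneous space is the space of coinvariants of `A` under its quotient. -/
theorem coactionDefect_self_exact :
    Function.Exact (inclusionLinear P) (coactionDefect P P le_rfl) := by
  -- Reflection of exactness: it suffices to argue after A ⊗_P -.
  refine (hP.faithfullyFlat P A (A ⊗[ℂ] QuotientHopf P) _ _).2 fun t => ?_
  obtain ⟨u, rfl⟩ := Submodule.mkQ_surjective _ t
  constructor
  · intro hu
    -- w(a ⊗ a') = aa'₁ ⊗ a'₂ - aa' ⊗ 1. Modulo π_P it is the induced defect map followed by
    -- multiplication of the two A-factors, and `shear` carries it to a ⊗ a' - aa' ⊗ 1.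
    let w : A ⊗[ℂ] A →ₗ[ℂ] A ⊗[ℂ] A := (LinearMap.mul' ℂ A).rTensor A ∘ₗ
      (TensorProduct.assoc ℂ A A A).symm.toLinearMap ∘ₗ
        (Coalgebra.comul - (TensorProduct.mk ℂ A A).flip 1).lTensor A
    have hw : ∀ u, mulOver P _ (TensorOver.map P (coactionDefect P P le_rfl) (Submodule.mkQ _ u)) =
        (proj P).toLinearMap.lTensor A (w u) := by
      intro u
      induction u with
      | zero => simp
      | add x y hx hy => simp only [map_add, hx, hy]
      | tmul a a' =>
        change (LinearMap.mul' ℂ A).rTensor _ ((TensorProduct.assoc ℂ A A _).symm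
          (a ⊗ₜ coactionDefect P P le_rfl a')) = _
        simp only [w, coactionDefect_eq_lTensor, LinearMap.comp_apply, LinearMap.lTensor_tmul,
          LinearMap.sub_apply, LinearMap.flip_apply, TensorProduct.mk_apply]
        induction Coalgebra.comul (R := ℂ) a' - a' ⊗ₜ[ℂ] (1 : A) with
        | zero => simp
        | add x y hx hy => simp only [map_add, TensorProduct.tmul_add, hx, hy]
        | tmul x y => simp
    have hs : ∀ u, shear A (w u) = u - LinearMap.mul' ℂ A u ⊗ₜ 1 := by
      intro u
      induction u with
      | zero => simp
      | add x y hx hy => simp only [map_add, TensorProduct.add_tmul, hx, hy]; abel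
      | tmul a a' =>
        have e : w (a ⊗ₜ a') = (a ⊗ₜ 1) * (Coalgebra.comul (R := ℂ) a' - a' ⊗ₜ 1) := by
          simp only [w, LinearMap.comp_apply, LinearMap.lTensor_tmul,
            LinearMap.sub_apply, LinearMap.flip_apply, TensorProduct.mk_apply]
          induction Coalgebra.comul (R := ℂ) a' - a' ⊗ₜ[ℂ] (1 : A) with
          | zero => simp
          | add x y hx hy => simp only [map_add, mul_add, TensorProduct.tmul_add, hx, hy]
          | tmul x y => simp
        rw [e, shear_tmul_one_mul, map_sub, shear_comul, shear_tmul]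
        simp [mul_sub, antipodeComul, Algebra.TensorProduct.one_def]
    have h0 : (proj P).toLinearMap.lTensor A (w u) = 0 := by rw [← hw, hu, map_zero]
    have := shear_mem_balancedRelations P h0
    rw [hs] at this
    -- Now u and mul(u) ⊗ 1 agree in A ⊗_P A, and the latter comes from A ⊗_P P because 1 ∈ P.
    refine ⟨Submodule.mkQ _ (LinearMap.mul' ℂ A u ⊗ₜ 1), ?_⟩
    refine Eq.trans ?_ ((Submodule.Quotient.eq _).2 this).symm
    rfl
  · rintro ⟨s, hs⟩
    obtain ⟨s, rfl⟩ := Submodule.mkQ_surjective _ s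
    rw [← hs]
    induction s generalizing u with
    | zero => simp
    | add x y hx hy => simp only [map_add, hx _ rfl, hy _ rfl, add_zero]
    | tmul a p =>
      have hp : coactionDefect P P le_rfl (p : A) = 0 :=
        sub_eq_zero.2 (lTensor_proj_comul P p.2)
      change Submodule.mkQ _ (a ⊗ₜ coactionDefect P P le_rfl (p : A)) = 0
      rw [hp, TensorProduct.tmul_zero, map_zero]

theorem rightCoaction_eq_tmul_one_iff (a : A) : rightCoaction P a = a ⊗ₜ 1 ↔ a ∈ P := by
  rw [← sub_eq_zero]
  refine (coactionDefect_self_exact P a).trans ⟨?_, fun ha => ⟨⟨a, ha⟩, rfl⟩⟩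
  rintro ⟨p, rfl⟩
  exact p.2

/-! ### Coinvariants of π_B(A) as the image of P. -/

variable [hB : IsQuantumHomogeneousSpace B]

theorem comul_proj (a : A) : Coalgebra.comul (R := ℂ) (proj B a) =
    (proj B).toLinearMap.rTensor _ (rightCoaction B a) := by
  rw [rightCoaction, LinearMap.comp_apply, ← LinearMap.comp_apply, LinearMap.rTensor_comp_lTensor]
  exact (CoalgHomClass.map_comp_comul_apply (projBialgHom B) a).symm

theorem lTensor_projNested_rightCoaction (h : B ≤ P) (a : A) :
    (projNested B P h).toLinearMap.lTensor A (rightCoaction B a) = rightCoaction P a := by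
  rw [rightCoaction, LinearMap.comp_apply, ← LinearMap.comp_apply, ← LinearMap.lTensor_comp]
  rfl

/-- Since Δ(π_B(a)) = π_B(a₁) ⊗ π_B(a₂), applying π_{B,P} to the second leg gives π_B(a₁) ⊗ π_P(a₂).
-/
theorem proj_mem_coinvariants_iff (h : B ≤ P) (a : A) :
    proj B a ∈ coinvariants B P h ↔
      (proj B).toLinearMap.rTensor (QuotientHopf P) (coactionDefect B P h a) = 0 := by
  rw [coactionDefect_apply, map_sub, sub_eq_zero]
  change (projNested B P h).toLinearMap.lTensor _ (Coalgebra.comul (R := ℂ) (proj B a)) =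
    proj B a ⊗ₜ 1 ↔ _
  rw [comul_proj, ← LinearMap.comp_apply, LinearMap.lTensor_comp_rTensor,
    ← LinearMap.rTensor_comp_lTensor, LinearMap.comp_apply, lTensor_projNested_rightCoaction]
  rfl

theorem proj_mem_coinvariants (h : B ≤ P) {p : A} (hp : p ∈ P) :
    proj B p ∈ coinvariants B P h := by
  rw [proj_mem_coinvariants_iff, coactionDefect_apply, (rightCoaction_eq_tmul_one_iff P p).2 hp,
    sub_self, map_zero]

/-- Coinvariance puts a₁ ⊗ π_P(a₂) - a ⊗ 1 into B⁺A ⊗ π_P(A), and S(k₁) ⊗ k₂ vanishes in A ⊗_B A for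
k ∈ B⁺A. -/
theorem map_coactionDefect_antipodeComul (h : B ≤ P) {a : A}
    (ha : proj B a ∈ coinvariants B P h) :
    TensorOver.map B (coactionDefect B P h) (Submodule.mkQ _ (antipodeComul A a)) = 0 := by
  rw [proj_mem_coinvariants_iff] at ha
  have hex : Function.Exact (LinearMap.ker (proj B).toLinearMap).subtype (proj B).toLinearMap :=
    LinearMap.exact_subtype_ker_map _
  obtain ⟨s, hs⟩ := (Module.Flat.rTensor_exact (QuotientHopf P) hex _).1 ha
  refine (Submodule.Quotient.mk_eq_zero _).2 ?_
  rw [lTensor_coactionDefect_antipodeComul, ← hs]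
  clear hs
  induction s with
  | zero => simp
  | add x y hx hy => simp only [map_add]; exact add_mem hx hy
  | tmul k d =>
    -- Appending the fixed factor d is left B-linear, so it preserves the balancing relations.
    let f : A →ₗ[B] A ⊗[ℂ] QuotientHopf P :=
      { toFun := fun a => a ⊗ₜ d
        map_add' := fun x y => TensorProduct.add_tmul x y d
        map_smul' := fun _ _ => rfl }
    have e : ∀ s : A ⊗[ℂ] A, TensorProduct.assoc ℂ A A _ (s ⊗ₜ d) =
        (f.restrictScalars ℂ).lTensor A s := by
      intro s
      induction s with
      | zero => simp
      | add x y hx hy => simp only [map_add, TensorProduct.add_tmul, hx, hy]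
      | tmul x y => rfl
    rw [LinearMap.rTensor_tmul, LinearMap.rTensor_tmul, e]
    exact balancedRelations_le_comap B f
      (antipodeComul_mem_balancedRelations B ((proj_eq_zero_iff B _).1 k.2))

/-- The map `A ⊗ A → π_B(A)`, `a ⊗ a' ↦ ε(a) π_B(a')`. -/
noncomputable def counitProj : A ⊗[ℂ] A →ₗ[ℂ] QuotientHopf B :=
  (proj B).toLinearMap ∘ₗ (TensorProduct.lid ℂ A).toLinearMap ∘ₗ
    (Coalgebra.counit (R := ℂ) (A := A)).rTensor A

theorem counitProj_tmul (a a' : A) :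
    counitProj B (a ⊗ₜ a') = Coalgebra.counit (R := ℂ) a • proj B a' := by
  simp [counitProj]

/-- On B the projection π_B is the scalar ε, and ε is multiplicative. So ε ⊗ π_B factors through A
⊗_B A. -/
theorem counitProj_eq_zero {x : A ⊗[ℂ] A} (hx : x ∈ balancedRelations B A) :
    counitProj B x = 0 := by
  have hle : balancedRelations B A ≤ LinearMap.ker (counitProj B) := by
    refine Submodule.span_le.2 ?_
    rintro _ ⟨a, b, m, rfl⟩
    have hb : proj B b = algebraMap ℂ _ (Coalgebra.counit (R := ℂ) (b : A)) := mk_eq_counit B b.2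
    simp [counitProj_tmul, Subalgebra.smul_def, hb, mul_smul, ← Algebra.smul_def]
  exact hle hx

theorem counitProj_antipodeComul (a : A) : counitProj B (antipodeComul A a) = proj B a := by
  have e : Coalgebra.counit ∘ₗ HopfAlgebra.antipode ℂ = Coalgebra.counit (R := ℂ) (A := A) :=
    LinearMap.ext fun a => HopfAlgebra.counit_antipode a
  rw [counitProj, antipodeComul, LinearMap.comp_apply, LinearMap.comp_apply, LinearMap.comp_apply,
    ← LinearMap.comp_apply ((Coalgebra.counit (R := ℂ) (A := A)).rTensor A),
    ← LinearMap.rTensor_comp, e, Coalgebra.rTensor_counit_comul]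
  simp

theorem map_proj_eq_coinvariants (h : B ≤ P) :
    (Subalgebra.toSubmodule P).map (proj B).toLinearMap = coinvariants B P h := by
  refine le_antisymm (Submodule.map_le_iff_le_comap.2 fun p hp => proj_mem_coinvariants B P h hp)
    fun x hx => ?_
  obtain ⟨a, rfl⟩ := proj_surjective B x
  -- Preservation of exactness over B, for the kernel of the defect. As a set this kernel is P,
  -- which is used at the end.
  have hex := (hB.faithfullyFlat _ _ _ (LinearMap.ker (coactionDefect B P h)).subtype
    (coactionDefect B P h)).1 (LinearMap.exact_subtype_ker_map _)
  obtain ⟨s, hs⟩ := (hex _).1 (map_coactionDefect_antipodeComul B P h hx)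
  obtain ⟨s, rfl⟩ := Submodule.mkQ_surjective _ s
  have h1 := counitProj_eq_zero B ((Submodule.Quotient.eq _).1 hs)
  rw [map_sub, counitProj_antipodeComul, sub_eq_zero] at h1
  rw [← h1]
  clear hs h1 hx
  induction s with
  | zero => simp
  | add x y hx hy => simp only [map_add]; exact add_mem hx hy
  | tmul c p =>
    rw [LinearMap.lTensor_tmul, counitProj_tmul]
    refine Submodule.smul_mem _ _ (Submodule.mem_map_of_mem (f := (proj B).toLinearMap) ?_)
    exact (rightCoaction_eq_tmul_one_iff P _).1 (sub_eq_zero.1 p.2)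

end Coinvariants

/-! ### The isomorphism of P with the cotensor product. -/

section Unit

variable {A : Type u} [Ring A] [HopfAlgebra ℂ A]
variable (B P : Subalgebra ℂ A) [hB : IsQuantumHomogeneousSpace B]
  [hP : IsQuantumHomogeneousSpace P] (h : B ≤ P)

theorem rightCoaction_coassoc (a : A) :
    TensorProduct.assoc ℂ A (QuotientHopf B) (QuotientHopf B)
      ((rightCoaction B).rTensor _ (rightCoaction B a)) =
    (Coalgebra.comul (R := ℂ)).lTensor A (rightCoaction B a) := by
  have e1 : ∀ s : A ⊗[ℂ] A, TensorProduct.assoc ℂ A (QuotientHopf B) (QuotientHopf B)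
      ((rightCoaction B).rTensor _ ((proj B).toLinearMap.lTensor A s)) =
      (TensorProduct.map (proj B).toLinearMap (proj B).toLinearMap).lTensor A
        (TensorProduct.assoc ℂ A A A ((Coalgebra.comul (R := ℂ) (A := A)).rTensor A s)) := by
    intro s
    induction s with
    | zero => simp
    | add x y hx hy => simp only [map_add, hx, hy]
    | tmul x y =>
      simp only [rightCoaction, LinearMap.rTensor_tmul, LinearMap.lTensor_tmul,
        LinearMap.comp_apply]
      induction Coalgebra.comul (R := ℂ) x with
      | zero => simp
      | add x y hx hy => simp only [map_add, TensorProduct.add_tmul, hx, hy]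
      | tmul z w => simp
  have e2 : Coalgebra.comul ∘ₗ (proj B).toLinearMap =
      TensorProduct.map (proj B).toLinearMap (proj B).toLinearMap ∘ₗ
        Coalgebra.comul (R := ℂ) (A := A) :=
    (CoalgHomClass.map_comp_comul (projBialgHom B)).symm
  rw [rightCoaction, LinearMap.comp_apply, ← rightCoaction, e1, Coalgebra.coassoc_apply,
    ← LinearMap.lTensor_comp_apply, ← LinearMap.lTensor_comp_apply, e2]

/-- The counit on the second tensor factor `A ⊗ π_B(A) → A`. -/
noncomputable def counitRight : A ⊗[ℂ] QuotientHopf B →ₗ[ℂ] A :=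
  (TensorProduct.rid ℂ A).toLinearMap ∘ₗ (Coalgebra.counit (R := ℂ)).lTensor A

theorem counit_proj (a : A) :
    Coalgebra.counit (R := ℂ) (proj B a) = Coalgebra.counit (R := ℂ) a :=
  CoalgHomClass.counit_comp_apply (projBialgHom B) a

theorem counitRight_rightCoaction (a : A) : counitRight B (rightCoaction B a) = a := by
  have e : Coalgebra.counit ∘ₗ (proj B).toLinearMap = Coalgebra.counit (R := ℂ) (A := A) :=
    LinearMap.ext (counit_proj B)
  rw [counitRight, rightCoaction, LinearMap.comp_apply, LinearMap.comp_apply,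
    ← LinearMap.lTensor_comp_apply, e, Coalgebra.lTensor_counit_comul]
  simp

theorem rightCoaction_injective : Function.Injective (rightCoaction B) :=
  Function.LeftInverse.injective (counitRight_rightCoaction B)

/-- The map `P → π_B(A)^{co(π_P(A))}`, `p ↦ π_B(p)`. -/
noncomputable def projFiber : P →ₗ[ℂ] coinvariants B P h :=
  ((proj B).toLinearMap ∘ₗ P.val.toLinearMap).codRestrict _
    fun p => proj_mem_coinvariants B P h p.2

theorem lTensor_subtype_projFiber (p : P) :
    (coinvariants B P h).subtype.lTensor A ((projFiber B P h).lTensor A (leftCoaction P p)) =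
      rightCoaction B (p : A) := by
  rw [rightCoaction, LinearMap.comp_apply, ← lTensor_leftCoaction, ← LinearMap.lTensor_comp_apply,
    ← LinearMap.lTensor_comp_apply]
  rfl

theorem lTensor_subtype_injective :
    Function.Injective ((coinvariants B P h).subtype.lTensor A) :=
  lTensor_inj A _ Subtype.val_injective

theorem subtype_fiber_coaction (x : (fiber B P h).carrier) :
    (coinvariants B P h).subtype.lTensor (QuotientHopf B) ((fiber B P h).coaction x) =
      Coalgebra.comul (R := ℂ) ((coinvariants B P h).subtype x) :=
  lTensor_corestrict (Coalgebra.comul ∘ₗ (coinvariants B P h).subtype) _ Subtype.val_injective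
    (comul_mem_of_coinvariants B P h) x

/-- Tensoring over a field keeps the inclusion of the coinvariants injective, so the cotensor
condition may be tested inside A ⊗ π_B(A). -/
theorem mem_cotensorProduct_fiber_iff (x : A ⊗[ℂ] coinvariants B P h) :
    x ∈ cotensorProduct (fiber B P h) ↔
      TensorProduct.assoc ℂ A (QuotientHopf B) (QuotientHopf B) ((rightCoaction B).rTensor _
        ((coinvariants B P h).subtype.lTensor A x)) =
      (Coalgebra.comul (R := ℂ)).lTensor A ((coinvariants B P h).subtype.lTensor A x) := by
  let ι := (coinvariants B P h).subtype
  have e1 : (ι.lTensor (QuotientHopf B)).lTensor A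
      (TensorProduct.assoc ℂ A (QuotientHopf B) _ ((rightCoaction B).rTensor _ x)) =
      TensorProduct.assoc ℂ A (QuotientHopf B) (QuotientHopf B) ((rightCoaction B).rTensor _
        (ι.lTensor A x)) := by
    induction x with
    | zero => simp
    | add x y hx hy => simp only [map_add, hx, hy]
    | tmul a v =>
      simp only [LinearMap.rTensor_tmul, LinearMap.lTensor_tmul]
      induction rightCoaction B a with
      | zero => simp
      | add x y hx hy => simp only [map_add, TensorProduct.add_tmul, hx, hy]
      | tmul z w => simp
  have e2 : (ι.lTensor (QuotientHopf B)).lTensor A ((fiber B P h).coaction.lTensor A x) =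
      (Coalgebra.comul (R := ℂ)).lTensor A (ι.lTensor A x) := by
    refine (LinearMap.lTensor_comp_apply A (ι.lTensor (QuotientHopf B))
      (fiber B P h).coaction x).symm.trans ?_
    rw [← LinearMap.lTensor_comp_apply]
    congr 2
    exact LinearMap.ext (subtype_fiber_coaction B P h)
  rw [← e1, ← e2]
  exact (lTensor_inj A _ (lTensor_inj _ ι Subtype.val_injective)).eq_iff.symm

/-- The map `P → A □_{π_B} π_B(A)^{co(π_P(A))}`, `p ↦ p₁ ⊗ π_B(p₂)`. -/
noncomputable def unitMap : P →ₗ[ℂ] Cotensor (fiber B P h) :=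
  LinearMap.codRestrict (cotensorProduct (fiber B P h))
    ((projFiber B P h).lTensor A ∘ₗ leftCoaction P) fun p => by
      refine (mem_cotensorProduct_fiber_iff B P h _).2 ?_
      have e := lTensor_subtype_projFiber B P h p
      refine (congrArg _ (congrArg _ e)).trans ?_
      exact (rightCoaction_coassoc B _).trans (congrArg _ e.symm)

theorem lTensor_subtype_unitMap (p : P) :
    (coinvariants B P h).subtype.lTensor A (cotensorInclusion (fiber B P h) (unitMap B P h p)) =
      rightCoaction B (p : A) :=
  lTensor_subtype_projFiber B P h p

theorem lTensor_subtype_cotensorInclusion_injective : Function.Injective fun x =>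
    (coinvariants B P h).subtype.lTensor A (cotensorInclusion (fiber B P h) x) :=
  (lTensor_subtype_injective B P h).comp (cotensorInclusion_injective (fiber B P h))

/-- Apply ε to the last factor of the cotensor equation. Together with `counitRight_rightCoaction`
this is A ≅ A □ π_B(A). -/
theorem rightCoaction_counitRight {x : A ⊗[ℂ] QuotientHopf B}
    (hx : TensorProduct.assoc ℂ A (QuotientHopf B) (QuotientHopf B)
      ((rightCoaction B).rTensor _ x) = (Coalgebra.comul (R := ℂ)).lTensor A x) :
    rightCoaction B (counitRight B x) = x := by
  let ε₃ : A ⊗[ℂ] (QuotientHopf B ⊗[ℂ] QuotientHopf B) →ₗ[ℂ] A ⊗[ℂ] QuotientHopf B :=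
    ((TensorProduct.rid ℂ _).toLinearMap ∘ₗ (Coalgebra.counit (R := ℂ)).lTensor _).lTensor A
  have e1 : ∀ x, ε₃ (TensorProduct.assoc ℂ A (QuotientHopf B) (QuotientHopf B)
      ((rightCoaction B).rTensor _ x)) = rightCoaction B (counitRight B x) := by
    intro x
    induction x with
    | zero => simp
    | add x y hx hy => simp only [map_add, hx, hy]
    | tmul a c =>
      simp only [LinearMap.rTensor_tmul, counitRight, LinearMap.comp_apply,
        LinearMap.lTensor_tmul, LinearEquiv.coe_coe, TensorProduct.rid_tmul, map_smul]
      induction rightCoaction B a with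
      | zero => simp
      | add x y hx hy => simp only [map_add, TensorProduct.add_tmul, smul_add, hx, hy]
      | tmul z w => simp [ε₃]
  have e2 : ((TensorProduct.rid ℂ (QuotientHopf B)).toLinearMap ∘ₗ
      (Coalgebra.counit (R := ℂ)).lTensor _) ∘ₗ Coalgebra.comul = LinearMap.id := by
    ext c
    simp [Coalgebra.lTensor_counit_comul]
  rw [← e1, hx, ← LinearMap.lTensor_comp_apply, e2, LinearMap.lTensor_id, LinearMap.id_apply]

/-- If `a₁ ⊗ π_B(a₂)` lies in `A ⊗ π_B(A)^{co(π_P(A))}`, then `a ∈ P`. -/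
theorem mem_of_rightCoaction_mem_range {a : A}
    (ha : rightCoaction B a ∈ LinearMap.range ((coinvariants B P h).subtype.lTensor A)) :
    a ∈ P := by
  rw [← rightCoaction_eq_tmul_one_iff]
  obtain ⟨y, hy⟩ := ha
  have h1 : ∀ y : A ⊗[ℂ] coinvariants B P h,
      (projNested B P h).toLinearMap.lTensor A ((coinvariants B P h).subtype.lTensor A y) =
        counitRight B ((coinvariants B P h).subtype.lTensor A y) ⊗ₜ 1 := by
    intro y
    induction y with
    | zero => simp
    | add x y hx hy => simp only [map_add, TensorProduct.add_tmul, hx, hy]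
    | tmul a v =>
      have hv : (projNested B P h).toLinearMap.lTensor (QuotientHopf B)
        (Coalgebra.comul (R := ℂ) (v : QuotientHopf B)) = v.1 ⊗ₜ[ℂ] (1 : QuotientHopf P) := v.2
      -- Applying ε to the first leg of the coinvariance equation gives π_{B,P}(v) = ε(v)1.
      have hv' := congrArg (TensorProduct.lid ℂ _ ∘
        (Coalgebra.counit (R := ℂ)).rTensor (QuotientHopf P)) hv
      simp only [Function.comp_apply] at hv'
      rw [← LinearMap.comp_apply, LinearMap.rTensor_comp_lTensor, ← LinearMap.lTensor_comp_rTensor,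
        LinearMap.comp_apply, Coalgebra.rTensor_counit_comul] at hv'
      simp only [LinearMap.lTensor_tmul, LinearMap.rTensor_tmul, TensorProduct.lid_tmul,
        one_smul] at hv'
      simp only [LinearMap.lTensor_tmul, counitRight, LinearMap.comp_apply, LinearEquiv.coe_coe,
        TensorProduct.rid_tmul, Submodule.subtype_apply, hv', TensorProduct.smul_tmul]
  have h2 := h1 y
  rwa [hy, lTensor_projNested_rightCoaction, counitRight_rightCoaction] at h2

theorem unitMap_bijective : Function.Bijective (unitMap B P h) := by
  constructor
  · intro p q hpq
    refine Subtype.ext (rightCoaction_injective B ?_)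
    rw [← lTensor_subtype_unitMap B P h, ← lTensor_subtype_unitMap B P h, hpq]
  · intro x
    have hx := rightCoaction_counitRight B ((mem_cotensorProduct_fiber_iff B P h x.1).1 x.2)
    -- The preimage is (id ⊗ ε)(x), found by unification with `hx`.
    refine ⟨⟨_, mem_of_rightCoaction_mem_range B P h ⟨x.1, hx.symm⟩⟩,
      lTensor_subtype_cotensorInclusion_injective B P h ?_⟩
    exact (lTensor_subtype_unitMap B P h _).trans hx

theorem unitMap_smul (b : B) (p : (nestedObject B P h).carrier) :
    unitMap B P h (b • p) = b • unitMap B P h p := by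
  apply lTensor_subtype_cotensorInclusion_injective B P h
  have e : ∀ x : A ⊗[ℂ] coinvariants B P h, (coinvariants B P h).subtype.lTensor A (b • x) =
      ((b : A) ⊗ₜ 1) * (coinvariants B P h).subtype.lTensor A x := by
    intro x
    induction x with
    | zero => simp
    | add x y hx hy => simp only [map_add, smul_add, mul_add, hx, hy]
    | tmul a v => simp [TensorProduct.smul_tmul', Subalgebra.smul_def]
  refine (lTensor_subtype_unitMap B P h _).trans ?_
  refine (rightCoaction_mul B b.2 (p : P).1).trans ?_
  exact (congrArg _ (lTensor_subtype_unitMap B P h p).symm).trans (e _).symm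

/-- After embedding both sides into A ⊗ (A ⊗ π_B(A)), each becomes p₁ ⊗ p₂ ⊗ π_B(p₃). -/
theorem unitMap_coaction (p : P) :
    cotensorCoaction (fiber B P h) (unitMap B P h p) =
      (unitMap B P h).lTensor A (leftCoaction P p) := by
  let ι := (coinvariants B P h).subtype
  apply lTensor_inj A _ (cotensorInclusion_injective (fiber B P h))
  refine (lTensor_cotensorCoaction (fiber B P h) _).trans ?_
  apply lTensor_inj A _ (lTensor_subtype_injective B P h)
  have e1 : ∀ x : A ⊗[ℂ] coinvariants B P h, (ι.lTensor A).lTensor A (comulLeft A _ x) =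
      comulLeft A _ (ι.lTensor A x) := by
    intro x
    induction x with
    | zero => simp
    | add x y hx hy => simp only [map_add, hx, hy]
    | tmul a v =>
      simp only [comulLeft_tmul, LinearMap.lTensor_tmul]
      induction Coalgebra.comul (R := ℂ) a with
      | zero => simp
      | add x y hx hy => simp only [map_add, hx, hy]
      | tmul z w => simp
  have e2 : ∀ s : A ⊗[ℂ] A, comulLeft A _ ((proj B).toLinearMap.lTensor A s) =
      ((proj B).toLinearMap.lTensor A).lTensor A
        (TensorProduct.assoc ℂ A A A ((Coalgebra.comul (R := ℂ) (A := A)).rTensor A s)) := by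
    intro s
    induction s with
    | zero => simp
    | add x y hx hy => simp only [map_add, hx, hy]
    | tmul a c =>
      simp only [comulLeft_tmul, LinearMap.lTensor_tmul, LinearMap.rTensor_tmul]
      induction Coalgebra.comul (R := ℂ) a with
      | zero => simp
      | add x y hx hy => simp only [map_add, TensorProduct.add_tmul, hx, hy]
      | tmul z w => simp
  let c : Cotensor (fiber B P h) →ₗ[ℂ] A ⊗[ℂ] coinvariants B P h :=
    cotensorInclusion (fiber B P h)
  have e3 : (ι.lTensor A ∘ₗ c) ∘ₗ unitMap B P h = rightCoaction B ∘ₗ P.val.toLinearMap :=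
    LinearMap.ext (lTensor_subtype_unitMap B P h)
  have e4 : ∀ t : A ⊗[ℂ] P, (ι.lTensor A).lTensor A
      (c.lTensor A ((unitMap B P h).lTensor A t)) =
      (rightCoaction B).lTensor A (P.val.toLinearMap.lTensor A t) := by
    intro t
    rw [← LinearMap.lTensor_comp_apply, ← LinearMap.lTensor_comp_apply, e3,
      LinearMap.lTensor_comp_apply]
  refine (e1 _).trans (Eq.trans ?_ (e4 _).symm)
  refine (congrArg (comulLeft A _) (lTensor_subtype_unitMap B P h p)).trans ?_
  rw [lTensor_leftCoaction, rightCoaction, LinearMap.comp_apply, e2, Coalgebra.coassoc_apply,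
    ← LinearMap.lTensor_comp_apply]

/-- The isomorphism `P ≅ A □_{π_B} π_B(A)^{co(π_P(A))}` of relative Hopf modules. -/
noncomputable def unitIso : nestedObject B P h ≅ cotensorObject (fiber B P h) :=
  let f : (nestedObject B P h).carrier →ₗ[B] (cotensorObject (fiber B P h)).carrier :=
    { toFun := unitMap B P h
      map_add' := map_add (unitMap B P h)
      map_smul' := unitMap_smul B P h }
  have hf : ∀ m, (cotensorObject (fiber B P h)).coaction (f m) =
      (f.restrictScalars ℂ).lTensor A ((nestedObject B P h).coaction m) := unitMap_coaction B P h
  let e := LinearEquiv.ofBijective f (unitMap_bijective B P h)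
  { hom := ⟨f, hf⟩
    inv := ⟨e.symm, fun m => by
      -- Colinearity of the inverse is checked on elements f(p), where it follows from colinearity
      -- of f.
      obtain ⟨p, rfl⟩ := e.surjective m
      have he : (e.symm.toLinearMap.restrictScalars ℂ) ∘ₗ (f.restrictScalars ℂ) =
          LinearMap.id := LinearMap.ext fun p => e.symm_apply_apply p
      refine (congrArg _ (e.symm_apply_apply p)).trans ?_
      refine Eq.trans ?_ (congrArg ((e.symm.toLinearMap.restrictScalars ℂ).lTensor A) (hf p)).symm
      rw [← LinearMap.lTensor_comp_apply, he, LinearMap.lTensor_id, LinearMap.id_apply]⟩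
    hom_inv_id := RelHopfModule.Hom.ext (LinearMap.ext fun p => e.symm_apply_apply p)
    inv_hom_id := RelHopfModule.Hom.ext (LinearMap.ext fun x => e.apply_symm_apply x) }

end Unit

end QHS

theorem mainTheorem11 {A : Type u} [Ring A] [HopfAlgebra ℂ A]
    (hS : Function.Bijective (HopfAlgebra.antipode ℂ (A := A)))
    (B P : Subalgebra ℂ A) [QHS.IsQuantumHomogeneousSpace B] [QHS.IsQuantumHomogeneousSpace P]
    (h : B ≤ P) :
    (∃ e : QHS.nestedObject B P h ≅ QHS.cotensorObject (QHS.fiber B P h),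
      ∀ p : P,
        (QHS.coinvariants B P h).subtype.lTensor A
            (QHS.cotensorInclusion (QHS.fiber B P h) (e.hom.toLinearMap p)) =
          (QHS.proj B).toLinearMap.lTensor A (Coalgebra.comul (R := ℂ) (p : A))) ∧
    (Subalgebra.toSubmodule P).map (QHS.proj B).toLinearMap = QHS.coinvariants B P h :=
  ⟨⟨QHS.unitIso B P h, QHS.lTensor_subtype_unitMap B P h⟩, QHS.map_proj_eq_coinvariants B P h⟩
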